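/- **Setting.** Let $X$ be the finite set of all points of the instance, with a distance function $\mathrm{dist}$ satisfying the axioms of a metric, except that distinct points may be at distance $0$; every non-zero distance is at least $1$, and $\Delta$ is the largest distance. Every point $x$ has a weight $w(x)>0$, and $k$ is the number of allowed centers. For a finite set $S$ let $\mathrm{dist}(x,S)=\min_{y\in S}\mathrm{dist}(x,y)$, with $\mathrm{dist}(x,\emptyset)=\Delta$. Put $\mathrm{cost}(U,P)=\sum_{x\in P}w(x)\,\mathrm{dist}(x,U)$, and let $\mathrm{OPT}(P)$ be the minimum of $\mathrm{cost}(U,P)$ over all $U\subseteq P$ with $|U|\le k$. A set $U\subseteq P$ with $|U|\le k$ is *$\alpha$-approximate for $P$* if $\mathrm{cost}(U,P)\le\alpha\,\mathrm{OPT}(P)$. For $p\in P$ write $\mathrm{Ball}_P(p,r)=\{x\in P:\mathrm{dist}(p,x)\le r\}$ and $\mathrm{avgcost}(p,B)=\mathrm{cost}(\{p\},B)/\sum_{x\in B}w(x)$. For an integer $t\ge 0$, a tuple $(p_0,\dots,p_t)$ of points of $P$ is *$t$-robust* if for every $i=1,\dots,t$, with $B=\mathrm{Ball}_P(p_i,10^i)$: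 $p_{i-1}=p_i$ if $\mathrm{avgcost}(p_i,B)\ge 10^i/5$, and otherwise $p_{i-1}$ is a point $p\in B$ that minimizes $\mathrm{cost}(\{p\},B)$ over $B$. A point $u$ is *$t$-robust* if it is the first entry $p_0$ of a $t$-robust tuple. A set $U$ of centers is *bounded-robust for $P$* if it is $100$-approximate for $P$ and every $u\in U$ is $t$-robust for the smallest integer $t\ge 0$ with $10^t\ge\mathrm{dist}(u,U\setminus\{u\})/200$. $\mathrm{Robustify}(W)$, for a point set $P\supseteq W$: while some $u\in W$ is not $t$-robust for the smallest integer $t\ge0$ with $10^t\ge\mathrm{dist}(u,W\setminus\{u\})/200$, take such a $u$, let $t'\ge 0$ be the smallest integer with $10^{t'}\ge\mathrm{dist}(u,W\setminus\{u\})/100$, compute a $t'$-robust tuple $(p_0,\dots,p_{t'})$ with $p_{t'}=u$, and replace $u$ by $p_0$ in $W$. **EpochAlgorithm.** The input is a set of centers $U^{(0)}$ of a point set $P^{(0)}$, followed by inserted points $\sigma_1,\sigma_2,\dots$; let $P^{(i)}=P^{(0)}\cup\{\sigma_1,\dots,\sigma_i\}$ and $c=228000$. 1. *Removing centers.* Choose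 an integer $\ell\ge0$ and a set $K\subseteq U^{(0)}$ with $|K|\le k-\ell$ and $\mathrm{cost}(K,P^{(0)})\le 3c\cdot\mathrm{cost}(U^{(0)},P^{(0)})$, such that $|V|\ge k-\ell$ for every $V\subseteq U^{(0)}$ with $\mathrm{cost}(V,P^{(0)})\le c\cdot\mathrm{cost}(U^{(0)},P^{(0)})$. 2. *Insertions.* For $1\le i\le\ell$ let $U^{(i)}=K\cup\{\sigma_1,\dots,\sigma_i\}$. 3. *Swapping and robustifying.* Let $\ell'=5\ell+5$. Choose $W\subseteq P^{(\ell+1)}$ with $|W|\le k$ and $|U^{(0)}\setminus W|\le4\ell'$ such that $\mathrm{cost}(W,P^{(\ell+1)})\le13\cdot\mathrm{cost}(V,P^{(\ell+1)})$ for every $V\subseteq P^{(\ell+1)}$ with $|V|\le k$, $|U^{(0)}\setminus V|\le\ell'$ and $|V\setminus U^{(0)}|\le\ell'$. Let $U^{(\ell+1)}$ be the output of $\mathrm{Robustify}(W)$ for $P^{(\ell+1)}$. All choices that are left open may be made arbitrarily. **Theorem.** Let $U^{(0)}$ be bounded-robust for $P^{(0)}$. The procedure $\mathrm{Robustify}$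 always terminates, EpochAlgorithm has a run on the input $U^{(0)},P^{(0)},\sigma$, and every run satisfies: - for $1\le i\le\ell$, the set $U^{(i)}$ is $(6\cdot100\cdot c)$-approximate for $P^{(i)}$; - if the insertions of the epoch increase the optimum by at most a factor of $18$, that is, $\mathrm{OPT}(P^{(\ell+1)})\le18\cdot\mathrm{OPT}(P^{(0)})$, then $U^{(\ell+1)}$ is bounded-robust for $P^{(\ell+1)}$. -/

import Mathlib

namespace ConsistentKMedian

/- Throughout, `X` is the finite set of all points of the instance. It carries a pseudometric, so
that several points of the stream may lie at the same location (a location which is inserted again,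
with a new weight, is a new element at distance `0`). The weight of a point is `w x`. -/

section Definitions

variable {X : Type*} [PseudoMetricSpace X]

/-- `dist(x, S)`, the distance from `x` to the closest point of `S`. By convention `dist(x, ∅) = Δ`,
the largest distance of the instance. -/
noncomputable def distTo (x : X) (S : Finset X) : ℝ :=
  if h : S.Nonempty then S.inf' h (fun y => dist x y) else Metric.diam (Set.univ : Set X)

/-- `cost(U, P) = ∑_{x ∈ P} w(x) · dist(x, U)`. -/
noncomputable def cost (w : X → ℝ) (U P : Finset X) : ℝ :=
  ∑ x ∈ P, w x * distTo x U

/-- `OPT(P)`, the minimum of `cost(U, P)` over all `U ⊆ P` with at most `k` points. -/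
noncomputable def opt (w : X → ℝ) (k : ℕ) (P : Finset X) : ℝ :=
  (P.powerset.filter (fun U => U.card ≤ k)).inf' ⟨∅, by simp⟩ (fun U => cost w U P)

/-- `U` is an `α`-approximate solution of the `k`-median problem on `P`. -/
structure IsApprox (w : X → ℝ) (k : ℕ) (α : ℝ) (P U : Finset X) : Prop where
  subset : U ⊆ P
  card_le : U.card ≤ k
  cost_le : cost w U P ≤ α * opt w k P

/-- The average cost `cost(u, P) / w(P)` of assigning the points of `P` to `u`. -/
noncomputable def avgcost (w : X → ℝ) (u : X) (P : Finset X) : ℝ :=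
  cost w {u} P / ∑ x ∈ P, w x

/-- `Ball_P(u, r)`. -/
noncomputable def ball (P : Finset X) (u : X) (r : ℝ) : Finset X :=
  P.filter (fun x => dist u x ≤ r)

/-- `q` is a legitimate choice of `p_{i-1}` when `p_i = p`: it is `p` if the average cost of
`Ball_P(p, 10^i)` is at least `10^i / 5`, and otherwise a minimizer of the cost of that ball among
the points of the ball. -/
def RobustLink (w : X → ℝ) (P : Finset X) (i : ℕ) (q p : X) : Prop :=
  ((10 : ℝ) ^ i / 5 ≤ avgcost w p (ball P p (10 ^ i)) → q = p) ∧
  (avgcost w p (ball P p (10 ^ i)) < (10 : ℝ) ^ i / 5 →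
    q ∈ ball P p (10 ^ i) ∧
      ∀ x ∈ ball P p (10 ^ i), cost w {q} (ball P p (10 ^ i)) ≤ cost w {x} (ball P p (10 ^ i)))

/-- `(p 0, p 1, …, p t)` is a `t`-robust tuple of points of `P` (later values of `p` are ignored).
The possible outputs of `MakeRobust(t, q)` are exactly the `t`-robust tuples with `p t = q`. -/
structure IsRobustTuple (w : X → ℝ) (P : Finset X) (t : ℕ) (p : ℕ → X) : Prop where
  mem : ∀ i ≤ t, p i ∈ P
  link : ∀ i < t, RobustLink w P (i + 1) (p i) (p (i + 1))

/-- The point `u` is `t`-robust with respect to `P`. -/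
def IsRobust (w : X → ℝ) (P : Finset X) (t : ℕ) (u : X) : Prop :=
  ∃ p : ℕ → X, IsRobustTuple w P t p ∧ p 0 = u

variable [DecidableEq X]

/-- `u` is `t`-robust for the smallest integer `t ≥ 0` with `10^t ≥ dist(u, U \ {u}) / 200`. -/
def IsRobustCenter (w : X → ℝ) (P U : Finset X) (u : X) : Prop :=
  ∃ t : ℕ, IsLeast {s : ℕ | distTo u (U.erase u) / 200 ≤ (10 : ℝ) ^ s} t ∧ IsRobust w P t u

/-- `U` is a bounded-robust set of centers for `P`. -/
structure BoundedRobust (w : X → ℝ) (k : ℕ) (P U : Finset X) : Prop where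
  approx : IsApprox w k 100 P U
  robust : ∀ u ∈ U, IsRobustCenter w P U u

/-- One iteration of the while-loop of `Robustify`: some center `u` of `W` that violates the
robustness condition is replaced by the point `p 0` of an output `(p 0, …, p t)` of
`MakeRobust(t, u)`, for the smallest integer `t ≥ 0` with `10^t ≥ dist(u, W \ {u}) / 100`. -/
def RobustifyStep (w : X → ℝ) (P W W' : Finset X) : Prop :=
  ∃ u ∈ W, ¬ IsRobustCenter w P W u ∧
    ∃ (t : ℕ) (p : ℕ → X),
      IsLeast {s : ℕ | distTo u (W.erase u) / 100 ≤ (10 : ℝ) ^ s} t ∧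
      IsRobustTuple w P t p ∧ p t = u ∧ W' = insert (p 0) (W.erase u)

/-- `U` is a possible output of `Robustify(W)` for the point set `P`: it is reached from `W` by
iterations of the loop, and the loop stops at `U`. -/
def IsRobustifyOutput (w : X → ℝ) (P W U : Finset X) : Prop :=
  Relation.ReflTransGen (RobustifyStep w P) W U ∧ ∀ u ∈ U, IsRobustCenter w P U u

/-- Every execution of `Robustify(W)` for the point set `P` stops after finitely many iterations. -/
def RobustifyTerminates (w : X → ℝ) (P W : Finset X) : Prop :=
  Acc (fun V' V => RobustifyStep w P V V') W

/-- Step 1 (removing centers) with parameter `c`: a set `K ⊆ U` of at most `k - ℓ` centers is kept,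
at cost at most `3 c · cost(U, P)`, where `ℓ` is at least the largest `ℓ*` such that some subset of
`U` of size at most `k - ℓ*` has cost at most `c · cost(U, P)`. -/
structure RemovalStep (w : X → ℝ) (k : ℕ) (c : ℝ) (P U : Finset X) (ℓ : ℕ) (K : Finset X) :
    Prop where
  subset : K ⊆ U
  card_le : K.card + ℓ ≤ k
  cost_le : cost w K P ≤ 3 * c * cost w U P
  maximal : ∀ V ⊆ U, cost w V P ≤ c * cost w U P → k ≤ V.card + ℓ

/-- The swapping part of Step 3 with parameter `s`: `W` has at most `k` centers, drops at most
`4 s` centers of `U`, and costs at most `13` times as much as any set of at most `k` centers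
obtained from `U` by at most `s` swaps. -/
structure SwapStep (w : X → ℝ) (k : ℕ) (P U : Finset X) (s : ℕ) (W : Finset X) : Prop where
  subset : W ⊆ P
  card_le : W.card ≤ k
  swaps : (U \ W).card ≤ 4 * s
  cost_le : ∀ V ⊆ P, V.card ≤ k → (U \ V).card ≤ s → (V \ U).card ≤ s →
    cost w W P ≤ 13 * cost w V P

/-- The first `i` inserted points of the stream `σ 0, σ 1, …`. -/
def inserted (σ : ℕ → X) (i : ℕ) : Finset X := (Finset.range i).image σ

/-- `P^(i)`, the set of points after `i` insertions. -/
def pointsAfter (P₀ : Finset X) (σ : ℕ → X) (i : ℕ) : Finset X := P₀ ∪ inserted σ i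

/-- `U 0, U 1, …, U (ℓ + 1)` are the sets of centers in a run of `EpochAlgorithm` on the centers
`U₀` of `P₀` and the stream `σ` of insertions, with `c = 228000` in Step 1 and `5 ℓ + 5` swaps in
Step 3. -/
structure IsEpochRun (w : X → ℝ) (k : ℕ) (P₀ : Finset X) (σ : ℕ → X) (U₀ : Finset X)
    (ℓ : ℕ) (U : ℕ → Finset X) : Prop where
  start : U 0 = U₀
  insertions : ∃ K : Finset X, RemovalStep w k 228000 P₀ U₀ ℓ K ∧
    ∀ i, 1 ≤ i → i ≤ ℓ → U i = K ∪ inserted σ i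
  final : ∃ W : Finset X, SwapStep w k (pointsAfter P₀ σ (ℓ + 1)) U₀ (5 * ℓ + 5) W ∧
    IsRobustifyOutput w (pointsAfter P₀ σ (ℓ + 1)) W (U (ℓ + 1))

end Definitions

end ConsistentKMedian

open ConsistentKMedian

namespace ConsistentKMedian

/-! ### Distances, costs and optima -/

section Basics

variable {X : Type*} [PseudoMetricSpace X]

/-! During the insertions every new point is itself a center, so the cost is at most that of `K` on
the initial points. That is at most `3c · 100` times the initial optimum, and enlarging the point
set at most halves the optimum (`opt_le_two_mul_opt`), whence `6 · 100 · c`.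

For the final set, let `V` be an optimal solution after all insertions. It costs at most `18 ·
cost(U₀)` on the old points, and Step 1 guarantees that at most `ℓ` centers of `U₀` can be dropped
cheaply. An old center that is nearest to no `v ∈ V`, or that forms an ill-separated pair with its
unique `v`, would be cheap to drop (for the ill-separated ones, half of them simultaneously), so all
but `4ℓ` centers of `V` lie in well-separated pairs with their nearest old center
(`exists_wellSeparated`). In such a pair the old center is robust at a scale above the pair's
distance, hence serves the cell of `v` at `3/2` times the cost of `v` (`IsRobust.cost_le`), provided
that the cell has no new point. Substituting old centers for such `v` gives a solution within the
allowed swaps (`exists_swap_solution`). The swap step loses a factor `13` and `Robustify` another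
`3/2`, in total below `100`.

`Robustify` is controlled by `RobustifyInv`: a replaced center never violates its condition again.
So each center moves at most once, which gives termination and lets the cost be compared cell by
cell with the initial set. -/

lemma distTo_singleton (x q : X) : distTo x {q} = dist x q := by simp [distTo]

lemma distTo_empty (x : X) : distTo x ∅ = Metric.diam (Set.univ : Set X) := by simp [distTo]

lemma distTo_le_dist {x y : X} {S : Finset X} (hy : y ∈ S) : distTo x S ≤ dist x y := by
  rw [distTo, dif_pos ⟨y, hy⟩]
  exact Finset.inf'_le _ hy

lemma exists_distTo_eq {S : Finset X} (hS : S.Nonempty) (x : X) :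
    ∃ y ∈ S, distTo x S = dist x y := by
  rw [distTo, dif_pos hS]
  exact Finset.exists_mem_eq_inf' hS _

lemma distTo_nonneg (x : X) (S : Finset X) : 0 ≤ distTo x S := by
  rcases S.eq_empty_or_nonempty with rfl | hS
  · rw [distTo_empty]; exact Metric.diam_nonneg
  · obtain ⟨y, -, h⟩ := exists_distTo_eq hS x
    rw [h]; exact dist_nonneg

lemma exists_nearest {S : Finset X} (hS : S.Nonempty) :
    ∃ a : X → X, ∀ x, a x ∈ S ∧ distTo x S = dist x (a x) := by
  choose a ha using exists_distTo_eq hS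
  exact ⟨a, ha⟩

lemma distTo_anti [Finite X] {x : X} {S T : Finset X} (h : S ⊆ T) :
    distTo x T ≤ distTo x S := by
  rcases S.eq_empty_or_nonempty with rfl | hS
  · rcases T.eq_empty_or_nonempty with rfl | hT
    · exact le_rfl
    · obtain ⟨y, -, hy⟩ := exists_distTo_eq hT x
      rw [hy, distTo_empty]
      exact Metric.dist_le_diam_of_mem (Set.toFinite _).isBounded (Set.mem_univ _) (Set.mem_univ _)
  · obtain ⟨y, hyS, hy⟩ := exists_distTo_eq hS x
    rw [hy]; exact distTo_le_dist (h hyS)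

variable {w : X → ℝ}

lemma cost_singleton (q : X) (S : Finset X) : cost w {q} S = ∑ x ∈ S, w x * dist x q := by
  simp [cost, distTo_singleton]

lemma cost_nonneg (hw : ∀ x, 0 < w x) (U P : Finset X) : 0 ≤ cost w U P :=
  Finset.sum_nonneg fun x _ => mul_nonneg (hw x).le (distTo_nonneg x U)

lemma cost_anti_left [Finite X] (hw : ∀ x, 0 < w x) {S T : Finset X} (h : S ⊆ T) (P : Finset X) :
    cost w T P ≤ cost w S P :=
  Finset.sum_le_sum fun x _ => mul_le_mul_of_nonneg_left (distTo_anti h) (hw x).le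

lemma cost_mono_right (hw : ∀ x, 0 < w x) (U : Finset X) {P Q : Finset X} (h : P ⊆ Q) :
    cost w U P ≤ cost w U Q :=
  Finset.sum_le_sum_of_subset_of_nonneg h fun x _ _ => mul_nonneg (hw x).le (distTo_nonneg x U)

lemma cost_le_of_distTo_le (hw : ∀ x, 0 < w x) {P S U V : Finset X} {a b : ℝ}
    (h : ∀ x ∈ P, distTo x S ≤ a * distTo x U + b * distTo x V) :
    cost w S P ≤ a * cost w U P + b * cost w V P := by
  rw [cost, cost, cost, Finset.mul_sum, Finset.mul_sum, ← Finset.sum_add_distrib]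
  refine Finset.sum_le_sum fun x hx => ?_
  calc w x * distTo x S ≤ w x * (a * distTo x U + b * distTo x V) :=
        mul_le_mul_of_nonneg_left (h x hx) (hw x).le
    _ = _ := by ring

/-- If every center `v` of `W` is replaced by `f v ∈ T`, and this multiplies the cost of the points
assigned to `v` by at most `C`, then `T` costs at most `C` times as much as `W`. -/
lemma cost_le_of_fiberwise [DecidableEq X] (hw : ∀ x, 0 < w x) {P W T : Finset X} {C : ℝ}
    {a f : X → X} (ha : ∀ x, a x ∈ W ∧ distTo x W = dist x (a x)) (hf : ∀ v ∈ W, f v ∈ T)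
    (h : ∀ v ∈ W, ∑ x ∈ P with a x = v, w x * dist x (f v) ≤
      C * ∑ x ∈ P with a x = v, w x * dist x v) :
    cost w T P ≤ C * cost w W P := by
  have h1 : cost w T P ≤ ∑ x ∈ P, w x * dist x (f (a x)) :=
    Finset.sum_le_sum fun x _ =>
      mul_le_mul_of_nonneg_left (distTo_le_dist (hf _ (ha x).1)) (hw x).le
  have h2 : cost w W P = ∑ x ∈ P, w x * dist x (a x) :=
    Finset.sum_congr rfl fun x _ => by rw [(ha x).2]
  rw [h2, ← Finset.sum_fiberwise_of_maps_to (t := W) (g := a) (fun x _ => (ha x).1), Finset.mul_sum]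
  rw [← Finset.sum_fiberwise_of_maps_to (t := W) (g := a) (fun x _ => (ha x).1)] at h1
  refine h1.trans (Finset.sum_le_sum fun v hv => ?_)
  refine le_trans (le_of_eq ?_) ((h v hv).trans (le_of_eq ?_))
  · exact Finset.sum_congr rfl fun x hx => by rw [(Finset.mem_filter.1 hx).2]
  · congr 1
    exact Finset.sum_congr rfl fun x hx => by rw [(Finset.mem_filter.1 hx).2]

lemma opt_le {k : ℕ} {U P : Finset X} (hU : U ⊆ P) (hk : U.card ≤ k) : opt w k P ≤ cost w U P := by
  unfold opt
  exact Finset.inf'_le (fun U => cost w U P) (by simp [hU, hk])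

lemma exists_opt_eq (w : X → ℝ) (k : ℕ) (P : Finset X) :
    ∃ V ⊆ P, V.card ≤ k ∧ opt w k P = cost w V P := by
  obtain ⟨V, hV, h⟩ := Finset.exists_mem_eq_inf'
    (s := P.powerset.filter (fun U => U.card ≤ k)) ⟨∅, by simp⟩ (fun U => cost w U P)
  simp only [Finset.mem_filter, Finset.mem_powerset] at hV
  exact ⟨V, hV.1, hV.2, h⟩

lemma opt_nonneg (hw : ∀ x, 0 < w x) (k : ℕ) (P : Finset X) : 0 ≤ opt w k P := by
  obtain ⟨V, -, -, h⟩ := exists_opt_eq w k P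
  rw [h]; exact cost_nonneg hw _ _

/-- Restricting the centers to a smaller set of points at most doubles the optimum. -/
lemma opt_le_two_mul_opt [DecidableEq X] (hw : ∀ x, 0 < w x) (k : ℕ) {P Q : Finset X}
    (h : P ⊆ Q) : opt w k P ≤ 2 * opt w k Q := by
  obtain ⟨V, -, hVk, hV⟩ := exists_opt_eq w k Q
  have hmono := cost_mono_right hw V h
  have hQ := opt_nonneg hw k Q
  rcases P.eq_empty_or_nonempty with rfl | hP
  · refine (opt_le (subset_refl _) (by simp)).trans ?_
    simpa [cost] using hQ
  rcases V.eq_empty_or_nonempty with rfl | hVne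
  · have := opt_le (w := w) (k := k) (U := ∅) (P := P) (by simp) (by simp)
    linarith
  -- Each center moves to its nearest point of `P`; for `x ∈ P` served by `v` this move is no longer
  -- than `dist x v`.
  obtain ⟨π, hπ⟩ := exists_nearest hP
  have h1 : opt w k P ≤ cost w (V.image π) P :=
    opt_le (Finset.image_subset_iff.2 fun v _ => (hπ v).1) (Finset.card_image_le.trans hVk)
  have h2 : cost w (V.image π) P ≤ 2 * cost w V P + 0 * cost w V P := by
    refine cost_le_of_distTo_le hw fun x hx => ?_
    obtain ⟨v, hv, hxv⟩ := exists_distTo_eq hVne x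
    have h3 := distTo_le_dist (x := x) (Finset.mem_image_of_mem π hv)
    have h4 := distTo_le_dist (x := v) hx
    have h5 := dist_triangle x v (π v)
    rw [(hπ v).2] at h4
    rw [dist_comm v x] at h4
    linarith
  linarith

end Basics

/-! ### Robust tuples -/

section Robust

variable {X : Type*} [PseudoMetricSpace X] {w : X → ℝ} {P : Finset X}

lemma mem_ball {u x : X} {r : ℝ} : x ∈ ball P u r ↔ x ∈ P ∧ dist u x ≤ r := by simp [ball]

lemma sum_dist_le (hw : ∀ x, 0 < w x) (S : Finset X) (p q : X) :
    ∑ x ∈ S, w x * dist x p ≤ ∑ x ∈ S, w x * dist x q + dist p q * ∑ x ∈ S, w x := by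
  rw [Finset.mul_sum, ← Finset.sum_add_distrib]
  refine Finset.sum_le_sum fun x _ => ?_
  have h := mul_le_mul_of_nonneg_left (dist_triangle x q p) (hw x).le
  rw [dist_comm q p] at h
  linarith

lemma dist_mul_sum_le (hw : ∀ x, 0 < w x) (S : Finset X) (p q : X) :
    dist p q * ∑ x ∈ S, w x ≤ ∑ x ∈ S, w x * dist x p + ∑ x ∈ S, w x * dist x q := by
  rw [Finset.mul_sum, ← Finset.sum_add_distrib]
  refine Finset.sum_le_sum fun x _ => ?_
  have h := mul_le_mul_of_nonneg_left (dist_triangle_left p q x) (hw x).le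
  linarith

lemma sum_ball_pos (hw : ∀ x, 0 < w x) {p : X} (hp : p ∈ P) {r : ℝ} (hr : 0 ≤ r) :
    0 < ∑ x ∈ ball P p r, w x :=
  Finset.sum_pos (fun x _ => hw x) ⟨p, mem_ball.2 ⟨hp, by simpa using hr⟩⟩

lemma RobustLink.eq_or_minimal (hw : ∀ x, 0 < w x) {i : ℕ} {q p : X} (h : RobustLink w P i q p)
    (hp : p ∈ P) :
    (q = p ∧ (10 : ℝ) ^ i / 5 * ∑ x ∈ ball P p (10 ^ i), w x ≤
        ∑ x ∈ ball P p (10 ^ i), w x * dist x p) ∨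
      (∑ x ∈ ball P p (10 ^ i), w x * dist x p < (10 : ℝ) ^ i / 5 * ∑ x ∈ ball P p (10 ^ i), w x ∧
        ∀ y ∈ ball P p (10 ^ i), ∑ x ∈ ball P p (10 ^ i), w x * dist x q ≤
          ∑ x ∈ ball P p (10 ^ i), w x * dist x y) := by
  have hpos := sum_ball_pos hw hp (r := (10 : ℝ) ^ i) (by positivity)
  rcases le_or_gt ((10 : ℝ) ^ i / 5) (avgcost w p (ball P p (10 ^ i))) with h1 | h1
  · refine Or.inl ⟨h.1 h1, ?_⟩
    rwa [avgcost, le_div_iff₀ hpos, cost_singleton] at h1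
  · refine Or.inr ⟨?_, fun y hy => ?_⟩
    · rwa [avgcost, div_lt_iff₀ hpos, cost_singleton] at h1
    · simpa only [cost_singleton] using (h.2 h1).2 y hy

lemma RobustLink.cost_le (hw : ∀ x, 0 < w x) {i : ℕ} {q p : X} (h : RobustLink w P i q p)
    (hp : p ∈ P) : ∑ x ∈ ball P p (10 ^ i), w x * dist x q ≤
      ∑ x ∈ ball P p (10 ^ i), w x * dist x p := by
  rcases h.eq_or_minimal hw hp with ⟨rfl, -⟩ | ⟨-, h⟩
  · exact le_rfl
  · exact h p (mem_ball.2 ⟨hp, by rw [dist_self]; positivity⟩)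

/-- If the point changes, both `p` and the minimizer `q` have average cost below `10^i / 5` on the
ball, and `dist q p` is at most the sum of these averages. Membership of `q` in the ball would only
give `10^i`. -/
lemma RobustLink.dist_le (hw : ∀ x, 0 < w x) {i : ℕ} {q p : X} (h : RobustLink w P i q p)
    (hp : p ∈ P) : dist q p ≤ 2 / 5 * 10 ^ i := by
  have hpos := sum_ball_pos hw hp (r := (10 : ℝ) ^ i) (by positivity)
  have h0 := h.cost_le hw hp
  rcases h.eq_or_minimal hw hp with ⟨rfl, -⟩ | ⟨h1, -⟩
  · rw [dist_self]; positivity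
  · have h2 := dist_mul_sum_le hw (ball P p (10 ^ i)) q p
    refine le_of_mul_le_mul_right ?_ hpos
    linarith

lemma exists_robustLink (w : X → ℝ) (i : ℕ) {p : X} (hp : p ∈ P) :
    ∃ q ∈ P, RobustLink w P i q p := by
  rcases le_or_gt ((10 : ℝ) ^ i / 5) (avgcost w p (ball P p (10 ^ i))) with h1 | h1
  · exact ⟨p, hp, fun _ => rfl, fun h => absurd h1 (not_le.2 h)⟩
  · obtain ⟨q, hq, hmin⟩ := Finset.exists_min_image (ball P p (10 ^ i))
      (fun q => cost w {q} (ball P p (10 ^ i))) ⟨p, mem_ball.2 ⟨hp, by rw [dist_self]; positivity⟩⟩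
    exact ⟨q, (mem_ball.1 hq).1, fun h => absurd h1 (not_lt.2 h), fun _ => ⟨hq, hmin⟩⟩

lemma exists_robustTuple (w : X → ℝ) (t : ℕ) {u : X} (hu : u ∈ P) :
    ∃ p, IsRobustTuple w P t p ∧ p t = u := by
  induction t generalizing u with
  | zero => exact ⟨fun _ => u, ⟨fun _ _ => hu, by simp⟩, rfl⟩
  | succ t ih =>
    obtain ⟨q, hq, hlink⟩ := exists_robustLink w (t + 1) hu
    obtain ⟨p, hp, hpt⟩ := ih hq
    refine ⟨fun i => if i ≤ t then p i else u, ⟨fun i hi => ?_, fun i hi => ?_⟩, by simp⟩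
    · by_cases h : i ≤ t
      · simpa [h] using hp.mem i h
      · simpa [h] using hu
    · rcases Nat.lt_succ_iff_lt_or_eq.1 hi with h | rfl
      · simpa [h.le, Nat.succ_le_of_lt h] using hp.link i h
      · simpa [hpt] using hlink

lemma IsRobustTuple.mono {s t : ℕ} {p : ℕ → X} (h : IsRobustTuple w P t p) (hst : s ≤ t) :
    IsRobustTuple w P s p :=
  ⟨fun i hi => h.mem i (hi.trans hst), fun i hi => h.link i (hi.trans_le hst)⟩

/-- Geometric series: `2/5 · (1 + 1/10 + 1/100 + …) = 4/9`. -/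
lemma IsRobustTuple.dist_le (hw : ∀ x, 0 < w x) {t : ℕ} {p : ℕ → X} (h : IsRobustTuple w P t p) :
    dist (p 0) (p t) ≤ 4 / 9 * 10 ^ t := by
  induction t with
  | zero => simpa using (by norm_num : (0 : ℝ) ≤ 4 / 9)
  | succ t ih =>
    have h1 := ih (h.mono t.le_succ)
    have h2 := (h.link t t.lt_succ_self).dist_le hw (h.mem _ le_rfl)
    have h3 := dist_triangle (p 0) (p t) (p (t + 1))
    rw [pow_succ] at h2 ⊢
    linarith

lemma IsRobustTuple.ball_subset (hw : ∀ x, 0 < w x) {t : ℕ} {p : ℕ → X}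
    (h : IsRobustTuple w P (t + 1) p) :
    ball P (p t) (10 ^ t) ⊆ ball P (p (t + 1)) (10 ^ (t + 1)) := by
  intro x hx
  rw [mem_ball] at hx ⊢
  refine ⟨hx.1, ?_⟩
  have h2 := (h.link t t.lt_succ_self).dist_le hw (h.mem _ le_rfl)
  have h3 := dist_triangle_left (p (t + 1)) x (p t)
  have h4 : (0 : ℝ) < 10 ^ t := by positivity
  rw [pow_succ] at h2 ⊢
  linarith [hx.2]

lemma IsRobustTuple.dist_le_of_far (hw : ∀ x, 0 < w x) {t : ℕ} {p : ℕ → X}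
    (h : IsRobustTuple w P t p) {x : X} (hx : 10 ^ t < dist (p t) x) :
    w x * dist x (p 0) ≤ 3 / 2 * (w x * dist x (p t)) := by
  have h2 := h.dist_le hw
  have h3 := dist_triangle x (p t) (p 0)
  have h4 : (0 : ℝ) < 10 ^ t := by positivity
  rw [dist_comm (p t) x] at hx
  rw [dist_comm (p t) (p 0)] at h3
  have h5 : dist x (p 0) ≤ 3 / 2 * dist x (p t) := by linarith
  have h6 := mul_le_mul_of_nonneg_left h5 (hw x).le
  linarith

/-- The first entry of a robust tuple is almost as good a center as the last one, for every
set of points that contains the last ball. -/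
lemma IsRobustTuple.cost_le [DecidableEq X] (hw : ∀ x, 0 < w x) {t : ℕ} {p : ℕ → X}
    (h : IsRobustTuple w P t p) {S : Finset X} (hB : ball P (p t) (10 ^ t) ⊆ S) (hS : S ⊆ P) :
    ∑ x ∈ S, w x * dist x (p 0) ≤ 3 / 2 * ∑ x ∈ S, w x * dist x (p t) := by
  induction t generalizing S with
  | zero =>
    exact le_mul_of_one_le_left (Finset.sum_nonneg fun x _ => mul_nonneg (hw x).le dist_nonneg)
      (by norm_num)
  | succ t ih =>
    have h1 := (h.link t t.lt_succ_self).cost_le hw (h.mem _ le_rfl)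
    have h2 := ih (h.mono t.le_succ) (h.ball_subset hw) (Finset.filter_subset _ _)
    -- The factor does not accumulate over the levels: inside the ball the last link does not
    -- increase the cost, so only the inductive factor is paid; outside, the whole displacement is
    -- small compared to the distance of the point.
    rw [← Finset.sum_sdiff hB, ← Finset.sum_sdiff hB, mul_add]
    refine add_le_add ?_ (by linarith)
    rw [Finset.mul_sum]
    refine Finset.sum_le_sum fun x hx => ?_
    rw [Finset.mem_sdiff, mem_ball, not_and, not_le] at hx
    exact h.dist_le_of_far hw (hx.2 (hS hx.1))

end Robust
end ConsistentKMedian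

namespace ConsistentKMedian

/-! ### Termination and cost of `Robustify` -/

section Robustify

variable {X : Type*} [PseudoMetricSpace X] {w : X → ℝ} {P : Finset X}

lemma exists_isLeast_pow (r : ℝ) : ∃ t : ℕ, IsLeast {s : ℕ | r ≤ (10 : ℝ) ^ s} t := by
  classical
  have h : ∃ s : ℕ, r ≤ (10 : ℝ) ^ s :=
    let ⟨s, hs⟩ := pow_unbounded_of_one_lt r (by norm_num : (1 : ℝ) < 10)
    ⟨s, hs.le⟩
  exact ⟨Nat.find h, Nat.find_spec h, fun _ hs => Nat.find_min' h hs⟩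

lemma IsRobust.mono {s t : ℕ} {u : X} (h : IsRobust w P t u) (hst : s ≤ t) : IsRobust w P s u := by
  obtain ⟨p, hp, h0⟩ := h
  exact ⟨p, hp.mono hst, h0⟩

variable [DecidableEq X]

lemma IsRobust.isRobustCenter {U : Finset X} {u : X} {t : ℕ} (h : IsRobust w P t u)
    (hU : distTo u (U.erase u) ≤ 200 * 10 ^ t) : IsRobustCenter w P U u := by
  obtain ⟨s, hs⟩ := exists_isLeast_pow (distTo u (U.erase u) / 200)
  exact ⟨s, hs, h.mono (hs.2 (by simp only [Set.mem_ofPred_eq]; linarith))⟩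

/-- A center which an iteration of `Robustify` replaces is processed at a scale `t ≥ 1`, so that
this scale is proportional to the distance to the other centers. -/
lemma lt_distTo_of_not_isRobustCenter {U : Finset X} {u : X} {t : ℕ} (hu : u ∈ P)
    (hn : ¬ IsRobustCenter w P U u)
    (ht : IsLeast {s : ℕ | distTo u (U.erase u) / 100 ≤ (10 : ℝ) ^ s} t) :
    10 * 10 ^ t < distTo u (U.erase u) ∧ distTo u (U.erase u) ≤ 100 * 10 ^ t := by
  have h1 : distTo u (U.erase u) / 100 ≤ (10 : ℝ) ^ t := ht.1
  refine ⟨?_, by linarith⟩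
  rcases t with _ | t
  · refine absurd (IsRobust.isRobustCenter (t := 0) ⟨fun _ => u, ⟨fun _ _ => hu, by simp⟩, rfl⟩ ?_) hn
    rw [pow_zero] at h1 ⊢
    linarith
  · by_contra! h
    have := ht.2 (show t ∈ {s : ℕ | distTo u (U.erase u) / 100 ≤ (10 : ℝ) ^ s} by
      simp only [Set.mem_ofPred_eq]; rw [pow_succ] at h; linarith)
    omega

/-- The invariant of `Robustify(W₀)`: in the current set `W`, the center `u` of `W₀` has become
`φ u`, and the centers in `M` have been replaced, each of them once. -/
structure RobustifyInv (w : X → ℝ) (P W₀ M : Finset X) (φ : X → X) (W : Finset X) : Prop where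
  image_eq : W = W₀.image φ
  inj : ∀ u ∈ W₀, ∀ v ∈ W₀, φ u = φ v → u = v
  subset : M ⊆ W₀
  fixed : ∀ u, u ∉ M → φ u = u
  moved : ∀ m ∈ M, ∃ (t : ℕ) (p : ℕ → X), IsRobustTuple w P t p ∧ p t = m ∧ p 0 = φ m ∧
    (∀ u ∈ W₀, u ≠ m → 9 * 10 ^ t < dist m u) ∧
    -- A witness keeps the new center's nearest-center distance below `200 · 10^t`, so that
    -- `t`-robustness suffices. It starts within `(100 + 4/9) · 10^t`; the slack from `110` to `120`
    -- pays for the single later move of the witness. A lone center has the default distance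
    -- instead.
    ((W₀ = {m} ∧ Metric.diam (Set.univ : Set X) ≤ 100 * 10 ^ t) ∨
      ∃ u ∈ W₀, u ≠ m ∧ dist (φ m) (φ u) ≤ 120 * 10 ^ t ∧
        (u ∉ M → dist (φ m) (φ u) ≤ 110 * 10 ^ t))

lemma RobustifyInv.init (w : X → ℝ) (P W : Finset X) : RobustifyInv w P W ∅ id W :=
  ⟨by simp, by simp, by simp, by simp, by simp⟩

variable {W₀ M W W' : Finset X} {φ : X → X}

lemma RobustifyInv.isRobustCenter (h : RobustifyInv w P W₀ M φ W) {m : X} (hm : m ∈ M) :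
    IsRobustCenter w P W (φ m) := by
  obtain ⟨t, p, hp, -, h0, -, hd⟩ := h.moved m hm
  refine IsRobust.isRobustCenter (t := t) ⟨p, hp, h0⟩ ?_
  have h10 : (0 : ℝ) < 10 ^ t := by positivity
  rcases hd with ⟨hW, hd⟩ | ⟨u, hu, hum, hd, -⟩
  · have : W.erase (φ m) = ∅ := by rw [h.image_eq, hW]; simp
    rw [this, distTo_empty]
    linarith
  · have hmem : φ u ∈ W.erase (φ m) := by
      rw [Finset.mem_erase, h.image_eq]
      exact ⟨fun he => hum (h.inj u hu m (h.subset hm) he), Finset.mem_image_of_mem φ hu⟩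
    have := distTo_le_dist (x := φ m) hmem
    linarith

/-- The constant is `4/9` divided by the separation `9`. -/
lemma RobustifyInv.dist_le (hw : ∀ x, 0 < w x) (h : RobustifyInv w P W₀ M φ W) {u v : X}
    (hu : u ∈ W₀) (huv : u ≠ v) : dist v (φ v) ≤ 4 / 81 * dist v u := by
  by_cases hv : v ∈ M
  · obtain ⟨t, p, hp, ht, h0, hs, -⟩ := h.moved v hv
    have h1 := hp.dist_le hw
    have h2 := hs u hu huv
    rw [ht, h0, dist_comm] at h1
    linarith
  · rw [h.fixed v hv, dist_self]
    positivity

/-- The violating center cannot be in `M`, by `RobustifyInv.isRobustCenter`; it is therefore still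
an original center, and the tuple starts from that original position. -/
lemma RobustifyInv.step (hw : ∀ x, 0 < w x) (h : RobustifyInv w P W₀ M φ W)
    (hstep : RobustifyStep w P W W') :
    ∃ u ∉ M, ∃ φ', RobustifyInv w P W₀ (insert u M) φ' W' := by
  obtain ⟨u', hu', hn, t, p, hleast, hp, hpt, rfl⟩ := hstep
  obtain ⟨u, hu, rfl⟩ : ∃ u ∈ W₀, φ u = u' := by simpa [h.image_eq] using hu'
  have huM : u ∉ M := fun hm => hn (h.isRobustCenter hm)
  rw [h.fixed u huM] at hu' hn hleast hpt ⊢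
  have huP : u ∈ P := hpt ▸ hp.mem t le_rfl
  obtain ⟨hfar, hnear⟩ := lt_distTo_of_not_isRobustCenter huP hn hleast
  have h10 : (0 : ℝ) < 10 ^ t := by positivity
  have hd := hp.dist_le hw
  rw [hpt] at hd
  have hmem : ∀ v ∈ W₀, v ≠ u → φ v ∈ W.erase u := fun v hv hvu => by
    rw [Finset.mem_erase, h.image_eq]
    refine ⟨fun he => hvu (h.inj v hv u hu ?_), Finset.mem_image_of_mem φ hv⟩
    rw [he, h.fixed u huM]
  have hfar' : ∀ v ∈ W₀, v ≠ u → 10 * 10 ^ t < dist u (φ v) := fun v hv hvu =>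
    hfar.trans_le (distTo_le_dist (hmem v hv hvu))
  -- The loop sees the current positions `φ v`; the small displacements transfer separation to the
  -- original ones, turning `10` into `9`.
  have hsep : ∀ v ∈ W₀, v ≠ u → 9 * 10 ^ t < dist u v := fun v hv hvu => by
    have h1 := hfar' v hv hvu
    have h2 := h.dist_le hw hu hvu.symm
    have h3 := dist_triangle u v (φ v)
    rw [dist_comm v u] at h2
    linarith
  have hne : ∀ v ∈ W₀, v ≠ u → p 0 ≠ φ v := fun v hv hvu he => by
    have h1 := hfar' v hv hvu
    rw [dist_comm, he] at hd
    linarith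
  refine ⟨u, huM, Function.update φ u (p 0), ?_, ?_, ?_, ?_, ?_⟩
  · ext y
    simp only [Finset.mem_insert, Finset.mem_erase, h.image_eq, Finset.mem_image]
    constructor
    · rintro (rfl | ⟨hyu, v, hv, rfl⟩)
      · exact ⟨u, hu, by simp⟩
      · have hvu : v ≠ u := fun he => hyu (by rw [he, h.fixed u huM])
        exact ⟨v, hv, by simp [hvu]⟩
    · rintro ⟨v, hv, rfl⟩
      by_cases hvu : v = u
      · left; simp [hvu]
      · right
        refine ⟨?_, v, hv, by simp [hvu]⟩
        simpa [hvu] using (Finset.mem_erase.1 (hmem v hv hvu)).1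
  · intro v hv v' hv' he
    by_cases hvu : v = u <;> by_cases hvu' : v' = u
    · rw [hvu, hvu']
    · subst hvu
      simp only [Function.update_self, Function.update_of_ne hvu'] at he
      exact absurd he (hne v' hv' hvu')
    · subst hvu'
      simp only [Function.update_self, Function.update_of_ne hvu] at he
      exact absurd he.symm (hne v hv hvu)
    · simp only [Function.update_of_ne hvu', Function.update_of_ne hvu] at he
      exact h.inj v hv v' hv' he
  · exact Finset.insert_subset hu h.subset
  · intro v hv
    rw [Finset.mem_insert, not_or] at hv
    rw [Function.update_of_ne hv.1, h.fixed v hv.2]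
  · intro m hm
    by_cases hmu : m = u
    · subst hmu
      refine ⟨t, p, hp, hpt, by simp, hsep, ?_⟩
      rcases (W.erase m).eq_empty_or_nonempty with he | hE
      · left
        rw [he, distTo_empty] at hnear
        refine ⟨Finset.eq_singleton_iff_unique_mem.2 ⟨hu, fun v hv => ?_⟩, hnear⟩
        by_contra hvm
        simpa [he] using hmem v hv hvm
      · right
        obtain ⟨y, hy, hyd⟩ := exists_distTo_eq hE m
        rw [Finset.mem_erase, h.image_eq, Finset.mem_image] at hy
        obtain ⟨hym, v, hv, rfl⟩ := hy
        have hvm : v ≠ m := fun he => hym (by rw [he, h.fixed m huM])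
        have h1 := dist_triangle (p 0) m (φ v)
        refine ⟨v, hv, hvm, ?_, fun _ => ?_⟩ <;>
        · simp only [Function.update_self, Function.update_of_ne hvm]
          linarith
    · have hmM := Finset.mem_of_mem_insert_of_ne hm hmu
      obtain ⟨s, q, hq, hqs, hq0, hs, hd'⟩ := h.moved m hmM
      refine ⟨s, q, hq, hqs, by rw [Function.update_of_ne hmu, hq0], hs, ?_⟩
      refine hd'.imp id ?_
      rintro ⟨v, hv, hvm, hv1, hv2⟩
      refine ⟨v, hv, hvm, ?_⟩
      rw [Function.update_of_ne hmu]
      -- The witness of `m` is the center moving now. Its scale satisfies `10 · 10^t < dist (φ m) v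
      -- ≤ 110 · 10^s`, so it moves by less than `5 · 10^s`.
      by_cases hvu : v = u
      · subst hvu
        refine ⟨?_, fun hn => absurd (Finset.mem_insert_self _ _) hn⟩
        rw [Function.update_self]
        have h1 := hv2 huM
        rw [h.fixed v huM] at h1
        have h2 := hfar' m (h.subset hmM) hmu
        have h3 := dist_triangle (φ m) v (p 0)
        rw [dist_comm v (φ m)] at h2
        rw [dist_comm v (p 0)] at h3
        linarith
      · rw [Function.update_of_ne hvu]
        exact ⟨hv1, fun hn => hv2 fun hvM => hn (Finset.mem_insert_of_mem hvM)⟩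

lemma RobustifyInv.acc (hw : ∀ x, 0 < w x) (h : RobustifyInv w P W₀ M φ W) :
    RobustifyTerminates w P W := by
  induction hn : (W₀ \ M).card using Nat.strong_induction_on generalizing M φ W with
  | _ n ih =>
    refine Acc.intro W fun W' hstep => ?_
    obtain ⟨u, hu, φ', h'⟩ := h.step hw hstep
    refine ih _ ?_ h' rfl
    rw [← hn]
    refine Finset.card_lt_card (Finset.ssubset_iff_of_subset ?_ |>.2 ⟨u, ?_, ?_⟩)
    · exact Finset.sdiff_subset_sdiff subset_rfl (Finset.subset_insert _ _)
    · exact Finset.mem_sdiff.2 ⟨h'.subset (Finset.mem_insert_self _ _), hu⟩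
    · simp

lemma robustifyTerminates (hw : ∀ x, 0 < w x) (P W : Finset X) : RobustifyTerminates w P W :=
  (RobustifyInv.init w P W).acc hw

lemma exists_robustifyInv (hw : ∀ x, 0 < w x)
    (h : Relation.ReflTransGen (RobustifyStep w P) W W') :
    ∃ M φ, RobustifyInv w P W M φ W' := by
  induction h with
  | refl => exact ⟨∅, id, .init w P W⟩
  | tail _ hstep ih =>
    obtain ⟨M, φ, h⟩ := ih
    obtain ⟨u, -, φ', h'⟩ := h.step hw hstep
    exact ⟨_, φ', h'⟩

lemma RobustifyStep.subset (hW : W ⊆ P) (h : RobustifyStep w P W W') : W' ⊆ P := by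
  obtain ⟨u, -, -, t, p, -, hp, -, rfl⟩ := h
  exact Finset.insert_subset (hp.mem 0 t.zero_le) ((Finset.erase_subset _ _).trans hW)

lemma exists_isRobustifyOutput (hw : ∀ x, 0 < w x) (hW : W ⊆ P) :
    ∃ U, IsRobustifyOutput w P W U := by
  induction robustifyTerminates hw P W with
  | intro W _ ih =>
    by_cases h : ∀ u ∈ W, IsRobustCenter w P W u
    · exact ⟨W, .refl, h⟩
    · push Not at h
      obtain ⟨u, hu, hn⟩ := h
      obtain ⟨t, ht⟩ := exists_isLeast_pow (distTo u (W.erase u) / 100)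
      obtain ⟨p, hp, hpt⟩ := exists_robustTuple w t (hW hu)
      have hstep : RobustifyStep w P W (insert (p 0) (W.erase u)) :=
        ⟨u, hu, hn, t, p, ht, hp, hpt, rfl⟩
      obtain ⟨U, h1, h2⟩ := ih _ hstep (hstep.subset hW)
      exact ⟨U, .head hstep h1, h2⟩

/-- `Robustify` increases the cost by at most a factor of `3 / 2`. -/
lemma IsRobustifyOutput.cost_le (hw : ∀ x, 0 < w x) {U : Finset X}
    (h : IsRobustifyOutput w P W U) : cost w U P ≤ 3 / 2 * cost w W P := by
  obtain ⟨M, φ, hI⟩ := exists_robustifyInv hw h.1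
  rcases W.eq_empty_or_nonempty with rfl | hW
  · have hU : U = ∅ := by simpa using hI.image_eq
    have := cost_nonneg hw ∅ P
    rw [hU]; linarith
  obtain ⟨a, ha⟩ := exists_nearest hW
  refine cost_le_of_fiberwise hw ha (f := φ)
    (fun v hv => hI.image_eq ▸ Finset.mem_image_of_mem φ hv) fun v hv => ?_
  by_cases hvM : v ∈ M
  · obtain ⟨t, p, hp, hpt, hp0, hs, -⟩ := hI.moved v hvM
    subst hpt
    rw [← hp0]
    -- The ball of radius `10^t` around a moved center lies in its cell, since all other centers of
    -- `W` are more than `9 · 10^t` away.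
    refine hp.cost_le hw (fun x hx => ?_) (Finset.filter_subset _ _)
    rw [mem_ball] at hx
    refine Finset.mem_filter.2 ⟨hx.1, ?_⟩
    by_contra hne
    have h1 := hs (a x) (ha x).1 hne
    have h2 := distTo_le_dist (x := x) hv
    rw [(ha x).2, dist_comm x (p t)] at h2
    have h3 := dist_triangle (p t) x (a x)
    have h10 : (0 : ℝ) < 10 ^ t := by positivity
    linarith
  · rw [hI.fixed v hvM]
    exact le_mul_of_one_le_left (Finset.sum_nonneg fun x _ => mul_nonneg (hw x).le dist_nonneg)
      (by norm_num)

lemma IsRobustifyOutput.subset (hW : W ⊆ P) {U : Finset X} (h : IsRobustifyOutput w P W U) :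
    U ⊆ P := by
  have h1 := h.1
  clear h
  induction h1 with
  | refl => exact hW
  | tail _ hstep ih => exact hstep.subset ih

lemma IsRobustifyOutput.card_le (hw : ∀ x, 0 < w x) {U : Finset X}
    (h : IsRobustifyOutput w P W U) : U.card ≤ W.card := by
  obtain ⟨M, φ, hI⟩ := exists_robustifyInv hw h.1
  rw [hI.image_eq]
  exact Finset.card_image_le

end Robustify
end ConsistentKMedian

namespace ConsistentKMedian

/-! ### Robust points compete with nearby points -/

section Comparison

variable {X : Type*} [PseudoMetricSpace X] {w : X → ℝ} {P : Finset X}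

/-- A `t`-robust point `u` is almost as good a center as any point `v` of `P` with
`20 · dist(u, v) ≤ 10 ^ t`, for every set that contains all points of `P` around `v`. -/
lemma IsRobust.cost_le [DecidableEq X] (hw : ∀ x, 0 < w x) {t : ℕ} {u v : X}
    (h : IsRobust w P t u) (hv : v ∈ P) (h1 : 1 ≤ dist u v) (ht : 20 * dist u v ≤ 10 ^ t)
    {C : Finset X} (hCP : C ⊆ P) (hC : ∀ x ∈ P, dist x v ≤ 400 * dist u v → x ∈ C) :
    ∑ x ∈ C, w x * dist x u ≤ 3 / 2 * ∑ x ∈ C, w x * dist x v := by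
  obtain ⟨p, hp, rfl⟩ := h
  -- The level of the tuple comparable to `dist u v`; `1 ≤ dist u v` rules out that level `0`
  -- already suffices.
  obtain ⟨i, hit, hi1, hi2⟩ : ∃ i < t, (10 : ℝ) ^ i < 20 * dist (p 0) v ∧
      20 * dist (p 0) v ≤ 10 ^ (i + 1) := by
    have hex : ∃ j : ℕ, 20 * dist (p 0) v ≤ 10 ^ j := ⟨t, ht⟩
    classical
    obtain ⟨j, hj⟩ : ∃ j, j = Nat.find hex := ⟨_, rfl⟩
    rcases j with _ | i
    · have := Nat.find_spec hex
      rw [← hj, pow_zero] at this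
      linarith
    · refine ⟨i, ?_, ?_, ?_⟩
      · have := Nat.find_min' hex ht
        omega
      · exact not_le.1 (Nat.find_min hex (by omega))
      · rw [hj]; exact Nat.find_spec hex
  set D := dist (p 0) v with hD
  have hpi := hp.mono hit.le
  have hpj := hp.mono (Nat.succ_le_of_lt hit)
  have hdi := hpi.dist_le hw
  have hdj := hpj.dist_le hw
  have hsub := hpj.ball_subset hw
  have hmem := hp.mem (i + 1) hit
  have hlink := hp.link i hit
  have hpow : (10 : ℝ) ^ (i + 1) = 10 * 10 ^ i := by rw [pow_succ]; ring
  have h10 : (0 : ℝ) < 10 ^ i := by positivity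
  rw [hpow] at hi2 hdj
  have hBP : ball P (p (i + 1)) (10 ^ (i + 1)) ⊆ P := Finset.filter_subset _ _
  have hBC : ball P (p (i + 1)) (10 ^ (i + 1)) ⊆ C := by
    intro x hx
    rw [mem_ball, hpow] at hx
    refine hC x hx.1 ?_
    have h2 := dist_triangle4 x (p (i + 1)) (p 0) v
    rw [dist_comm x (p (i + 1)), dist_comm (p (i + 1)) (p 0)] at h2
    linarith [hx.2]
  have hball : ∑ x ∈ ball P (p (i + 1)) (10 ^ (i + 1)), w x * dist x (p 0) ≤
      3 / 2 * ∑ x ∈ ball P (p (i + 1)) (10 ^ (i + 1)), w x * dist x v := by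
    rcases hlink.eq_or_minimal hw hmem with ⟨he, hlarge⟩ | ⟨-, hmin⟩
    -- The ball is expensive for `p (i + 1)`, hence also for the nearby `v`: at least `2 - 17/18`
    -- times `10^i` on average. Moving from `v` to `p 0` adds at most `10^i / 2`, which is less than
    -- half of that.
    · have h2 := sum_dist_le hw (ball P (p (i + 1)) (10 ^ (i + 1))) (p 0) v
      have h3 := sum_dist_le hw (ball P (p (i + 1)) (10 ^ (i + 1))) (p (i + 1)) v
      have h4 := sum_ball_pos hw hmem (r := (10 : ℝ) ^ (i + 1)) (by positivity)
      set B := ball P (p (i + 1)) (10 ^ (i + 1))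
      have h5 : dist (p (i + 1)) v ≤ (17 / 18) * 10 ^ i := by
        have := dist_triangle_left (p (i + 1)) v (p 0)
        rw [he] at hdi
        linarith
      have h6 := mul_le_mul_of_nonneg_right h5 h4.le
      have h7 := mul_le_mul_of_nonneg_right (show D ≤ 1 / 2 * 10 ^ i by linarith) h4.le
      rw [hpow] at hlarge
      have h8 := mul_pos h10 h4
      linarith
    -- Here `p i` is optimal among the points of the ball, and `v` is one of them.
    · have h2 := hpi.cost_le hw hsub hBP
      have h3 := hmin v (mem_ball.2 ⟨hv, by
        have := dist_triangle_left (p (i + 1)) v (p 0)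
        rw [hpow]; linarith⟩)
      linarith
  rw [← Finset.sum_sdiff hBC, ← Finset.sum_sdiff hBC, mul_add]
  refine add_le_add ?_ hball
  rw [Finset.mul_sum]
  refine Finset.sum_le_sum fun x hx => ?_
  rw [Finset.mem_sdiff, mem_ball, not_and, not_le, hpow] at hx
  have h2 := hx.2 (hCP hx.1)
  have h3 := dist_triangle (p (i + 1)) (p 0) x
  have h4 := dist_triangle x v (p 0)
  rw [dist_comm (p (i + 1)) (p 0), dist_comm (p 0) x] at h3
  rw [dist_comm v (p 0)] at h4
  have h5 : dist x (p 0) ≤ 3 / 2 * dist x v := by linarith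
  have h6 := mul_le_mul_of_nonneg_left h5 (hw x).le
  linarith

end Comparison

/-! ### Removing half of a set while keeping nearest neighbours -/

section Removal

variable {X : Type*} [PseudoMetricSpace X]

/-- The points of a finite set can be coloured with two colours such that every point has a nearest
neighbour of the other colour. -/
lemma exists_nearest_neighbour_colouring {U : Finset X} (hU : 1 < U.card) :
    ∃ χ : X → Bool, ∀ u ∈ U, ∃ v ∈ U, v ≠ u ∧ (∀ y ∈ U, y ≠ u → dist u v ≤ dist u y) ∧
      χ v ≠ χ u := by
  classical
  have hex : ∀ u : X, ∃ v ∈ U, v ≠ u ∧ ∀ y ∈ U, y ≠ u → dist u v ≤ dist u y := fun u => by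
    obtain ⟨v, hv, hmin⟩ := Finset.exists_min_image (U.erase u) (dist u) (by
      obtain ⟨v, hv, hvu⟩ := Finset.exists_mem_ne hU u
      exact ⟨v, Finset.mem_erase.2 ⟨hvu, hv⟩⟩)
    rw [Finset.mem_erase] at hv
    exact ⟨v, hv.2, hv.1, fun y hy hyu => hmin y (Finset.mem_erase.2 ⟨hyu, hy⟩)⟩
  choose ν hνU hν hmin using hex
  suffices H : ∀ A ⊆ U, ∃ χ : X → Bool, ∀ u ∈ A, ∃ v ∈ U, v ≠ u ∧
      (∀ y ∈ U, y ≠ u → dist u v ≤ dist u y) ∧ χ v ≠ χ u from H U subset_rfl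
  intro A
  -- Points are added by increasing nearest-neighbour distance.
  induction A using Finset.induction_on_max_value (fun u => dist u (ν u)) with
  | empty => exact fun _ => ⟨fun _ => true, by simp⟩
  | insert a s has hmax ih =>
    intro hA
    rw [Finset.insert_subset_iff] at hA
    obtain ⟨χ, hχ⟩ := ih hA.2
    -- If `a` is nearest to an earlier `x`, then `x` is also nearest to `a` by the order of
    -- insertion, so the colouring already works. Otherwise no earlier point relies on the colour of
    -- `a`, which may be reset.
    by_cases hx : ∃ x ∈ s, (∀ y ∈ U, y ≠ x → dist x a ≤ dist x y) ∧ χ a ≠ χ x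
    · obtain ⟨x, hxs, hxa, hne⟩ := hx
      refine ⟨χ, fun u hu => ?_⟩
      rcases Finset.mem_insert.1 hu with rfl | hus
      · have hxu : x ≠ u := fun h => has (h ▸ hxs)
        refine ⟨x, hA.2 hxs, hxu, fun y hy hyu => ?_, hne.symm⟩
        have h1 := hxa (ν x) (hνU x) (hν x)
        have h2 := hmax x hxs
        have h3 := hmin u y hy hyu
        rw [dist_comm u x]
        linarith
      · exact hχ u hus
    · push Not at hx
      refine ⟨Function.update χ a (!χ (ν a)), fun u hu => ?_⟩
      rcases Finset.mem_insert.1 hu with rfl | hus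
      · refine ⟨ν u, hνU u, hν u, hmin u, ?_⟩
        rw [Function.update_of_ne (hν u), Function.update_self]
        simp
      · obtain ⟨v, hv, hvu, hd, hne⟩ := hχ u hus
        have hva : v ≠ a := by
          rintro rfl
          exact hne (hx u hus hd)
        have hua : u ≠ a := fun h => has (h ▸ hus)
        refine ⟨v, hv, hvu, hd, ?_⟩
        rwa [Function.update_of_ne hva, Function.update_of_ne hua]

/-- At least half of the points of `A ⊆ U` can be removed from `U` such that each of them has a
nearest neighbour which is not removed. -/
lemma exists_half_removable [DecidableEq X] {U A : Finset X} (hU : 1 < U.card) (hA : A ⊆ U) :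
    ∃ R ⊆ A, A.card ≤ 2 * R.card ∧
      ∀ u ∈ R, ∃ v ∈ U \ R, ∀ y ∈ U, y ≠ u → dist u v ≤ dist u y := by
  obtain ⟨χ, hχ⟩ := exists_nearest_neighbour_colouring hU
  have key : ∀ b : Bool, ∀ u ∈ A.filter (χ · = b), ∃ v ∈ U \ A.filter (χ · = b),
      ∀ y ∈ U, y ≠ u → dist u v ≤ dist u y := by
    intro b u hu
    rw [Finset.mem_filter] at hu
    obtain ⟨v, hv, -, hd, hne⟩ := hχ u (hA hu.1)
    refine ⟨v, ?_, hd⟩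
    rw [Finset.mem_sdiff, Finset.mem_filter]
    exact ⟨hv, fun h => hne (h.2.trans hu.2.symm)⟩
  have hcard : (A.filter (χ · = true)).card + (A.filter (χ · = false)).card = A.card := by
    rw [← Finset.card_filter_add_card_filter_not (s := A) (χ · = true)]
    simp
  rcases le_total (A.filter (χ · = true)).card (A.filter (χ · = false)).card with h | h
  · exact ⟨_, Finset.filter_subset _ _, by omega, key false⟩
  · exact ⟨_, Finset.filter_subset _ _, by omega, key true⟩

end Removal
end ConsistentKMedian

namespace ConsistentKMedian

/-! ### Well-separated pairs and the swap solution -/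

section WellSeparated

variable {X : Type*} [PseudoMetricSpace X]

/-- The pair `(π v, v)` of a center of `U` and a center of `V` is well-separated: both are far from
the other centers of their set, compared to their distance. -/
def IsWellSeparated (γ : ℝ) (U V : Finset X) (π : X → X) (v : X) : Prop :=
  (∀ v' ∈ V, v' ≠ v → γ * dist v (π v) ≤ dist v v') ∧
    ∀ u ∈ U, u ≠ π v → γ * dist v (π v) ≤ dist (π v) u

variable {U V : Finset X} {π : X → X}

/-- If another `v'` is close to `v`, uniqueness makes `π v'` a different old center, and it is near
because `v'` is close to `π v`. -/
lemma exists_near_of_not_isWellSeparated {γ : ℝ} (hγ : 0 ≤ γ)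
    (hπ : ∀ x, π x ∈ U ∧ distTo x U = dist x (π x)) {v : X}
    (huniq : ∀ v' ∈ V, π v' = π v → v' = v) (hn : ¬ IsWellSeparated γ U V π v) :
    ∃ u ∈ U, u ≠ π v ∧ dist (π v) u ≤ (2 * γ + 2) * dist v (π v) := by
  have hnn := mul_nonneg hγ (dist_nonneg (x := v) (y := π v))
  have hd : 0 ≤ dist v (π v) := dist_nonneg
  rw [IsWellSeparated, not_and_or] at hn
  push Not at hn
  rcases hn with ⟨v', hv', hne, hlt⟩ | ⟨u, hu, hne, hlt⟩
  · refine ⟨π v', (hπ v').1, fun h => hne (huniq v' hv' h), ?_⟩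
    have h1 := distTo_le_dist (x := v') (hπ v).1
    rw [(hπ v').2] at h1
    have h2 := dist_triangle v' v (π v)
    have h3 := dist_triangle4 (π v) v v' (π v')
    rw [dist_comm (π v) v] at h3
    rw [dist_comm v' v] at h2
    linarith
  · exact ⟨u, hu, hne, by linarith⟩

variable [DecidableEq X]

lemma two_mul_card_image_le {Y : Type*} [DecidableEq Y] {π : Y → Y} {S : Finset Y}
    (hS : ∀ v ∈ S, ∃ v' ∈ S, v' ≠ v ∧ π v' = π v) : 2 * (S.image π).card ≤ S.card := by
  refine Finset.mul_card_image_le_card S 2 fun u hu => ?_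
  obtain ⟨v, hv, rfl⟩ := Finset.mem_image.1 hu
  obtain ⟨v', hv', hne, he⟩ := hS v hv
  exact Finset.one_lt_card.2
    ⟨v', Finset.mem_filter.2 ⟨hv', he⟩, v, Finset.mem_filter.2 ⟨hv, rfl⟩, hne⟩

variable {w : X → ℝ} {P : Finset X}

/-- Centers of `U` that are not the closest one to any center of `V` are cheap to remove. -/
lemma cost_image_nearest_le (hw : ∀ x, 0 < w x)
    (hπ : ∀ x, π x ∈ U ∧ distTo x U = dist x (π x)) (hV : V.Nonempty) :
    cost w (V.image π) P ≤ 1 * cost w U P + 2 * cost w V P := by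
  refine cost_le_of_distTo_le hw fun x _ => ?_
  obtain ⟨v, hv, hxv⟩ := exists_distTo_eq hV x
  have h1 := distTo_le_dist (x := x) (Finset.mem_image_of_mem π hv)
  have h2 := distTo_le_dist (x := v) (hπ x).1
  have h3 := dist_triangle x v (π v)
  have h4 := dist_triangle_left v (π x) x
  rw [(hπ v).2] at h2
  rw [hxv, (hπ x).2]
  linarith

/-- Centers `π v` of `U` which are matched with a single center `v` of `V` are cheap to remove if
a center at distance `O(dist(v, π v))` is kept. -/
lemma cost_sdiff_le (hw : ∀ x, 0 < w x) {ρ : ℝ} (hρ : 0 ≤ ρ)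
    (hπ : ∀ x, π x ∈ U ∧ distTo x U = dist x (π x)) (hV : V.Nonempty) {R : Finset X}
    (hR : ∀ v ∈ V, π v ∈ R → ∃ u ∈ U \ R, dist (π v) u ≤ ρ * dist v (π v)) :
    cost w (U \ R) P ≤ (1 + ρ) * cost w U P + (2 + ρ) * cost w V P := by
  refine cost_le_of_distTo_le hw fun x _ => ?_
  obtain ⟨v, hv, hxv⟩ := exists_distTo_eq hV x
  have h2 := distTo_le_dist (x := v) (hπ x).1
  have h3 := dist_triangle x v (π v)
  have h4 := dist_triangle_left v (π x) x
  rw [(hπ v).2] at h2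
  rw [hxv, (hπ x).2]
  have h5 : ρ * dist v (π v) ≤ ρ * (dist x v + dist x (π x)) :=
    mul_le_mul_of_nonneg_left (by linarith) hρ
  have h6 : 0 ≤ ρ * dist v (π v) := by positivity
  by_cases hvR : π v ∈ R
  · obtain ⟨u, hu, hd⟩ := hR v hv hvR
    have h7 := distTo_le_dist (x := x) hu
    have h8 := dist_triangle x (π v) u
    linarith
  · have h7 := distTo_le_dist (x := x) (Finset.mem_sdiff.2 ⟨(hπ v).1, hvR⟩)
    linarith

/-- If few centers can be removed from `U` at bounded cost, then most centers of `V` are in a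
well-separated pair. -/
lemma exists_wellSeparated (hw : ∀ x, 0 < w x) {k ℓ : ℕ}
    (hUk : U.card ≤ k) (hU1 : 1 < U.card) (hV : V.Nonempty) (hVk : V.card ≤ k)
    (hmax : ∀ T ⊆ U, cost w T P ≤ 228000 * cost w U P → k ≤ T.card + ℓ)
    (hcost : cost w V P ≤ 18 * cost w U P)
    (hπ : ∀ x, π x ∈ U ∧ distTo x U = dist x (π x)) :
    ∃ G ⊆ V, (∀ v ∈ G, IsWellSeparated 4000 U V π v) ∧
      (V \ G).card ≤ 4 * ℓ ∧ (U \ V.image π).card + ((V \ G).image π).card ≤ 4 * ℓ := by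
  classical
  have hU0 := cost_nonneg hw U P
  have himg : V.image π ⊆ U := Finset.image_subset_iff.2 fun v _ => (hπ v).1
  have h1 : k ≤ (V.image π).card + ℓ := hmax _ himg (by
    have := cost_image_nearest_le (P := P) hw hπ hV
    linarith)
  set S := V.filter fun v => ∀ v' ∈ V, π v' = π v → v' = v with hS
  set G := S.filter fun v => IsWellSeparated 4000 U V π v with hG
  have hSV : S ⊆ V := Finset.filter_subset _ _
  have hGS : G ⊆ S := Finset.filter_subset _ _
  -- Centers sharing an old center come at least in pairs, while the image of `V` loses at most `ℓ`
  -- of the budget `k`; hence `V \ S` has at most `2ℓ` elements.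
  have h2 : 2 * ((V \ S).image π).card ≤ (V \ S).card := by
    refine two_mul_card_image_le fun v hv => ?_
    rw [Finset.mem_sdiff, hS, Finset.mem_filter, not_and] at hv
    have hv2 := hv.2 hv.1
    push Not at hv2
    obtain ⟨v', hv', he, hne⟩ := hv2
    refine ⟨v', Finset.mem_sdiff.2 ⟨hv', fun h => ?_⟩, hne, he⟩
    exact hne ((Finset.mem_filter.1 h).2 v hv.1 he.symm).symm
  have h3 : (V.image π).card ≤ S.card + ((V \ S).image π).card := by
    rw [← Finset.union_sdiff_of_subset hSV, Finset.image_union, Finset.union_sdiff_of_subset hSV]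
    exact (Finset.card_union_le _ _).trans (Nat.add_le_add_right Finset.card_image_le _)
  have h4 : S.card + (V \ S).card = V.card := by
    rw [add_comm]; exact Finset.card_sdiff_add_card_eq_card hSV
  have h5 : (U \ V.image π).card + (V.image π).card = U.card :=
    Finset.card_sdiff_add_card_eq_card himg
  have hinj : Set.InjOn π S := fun v hv v' hv' he =>
    (Finset.mem_filter.1 hv').2 v (hSV hv) he
  have hAcard : ((S \ G).image π).card = (S \ G).card :=
    Finset.card_image_of_injOn (hinj.mono (by simp))
  obtain ⟨R, hRA, hR2, hR⟩ := exists_half_removable hU1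
    (A := (S \ G).image π) (Finset.image_subset_iff.2 fun v _ => (hπ v).1)
  have hRU : R ⊆ U := hRA.trans (Finset.image_subset_iff.2 fun v _ => (hπ v).1)
  have h6 : (S \ G).card ≤ 2 * ℓ := by
    have hk : k ≤ (U \ R).card + ℓ := hmax _ Finset.sdiff_subset (by
      -- With `ρ = 8002` the bound is `(1 + ρ) + 18 · (2 + ρ) = 152075` times `cost w U P`, below
      -- `228000`.
      have := cost_sdiff_le (P := P) hw (ρ := 2 * 4000 + 2) (by norm_num) hπ hV (R := R) (by
        intro v hv hvR
        obtain ⟨v₁, hv₁, he⟩ := Finset.mem_image.1 (hRA hvR)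
        rw [Finset.mem_sdiff] at hv₁
        have hv₁S := Finset.mem_filter.1 hv₁.1
        have hvv : v = v₁ := hv₁S.2 v hv he.symm
        subst hvv
        obtain ⟨u, hu, huv, hd⟩ := exists_near_of_not_isWellSeparated (γ := 4000) (by norm_num) hπ
          hv₁S.2 (fun h => hv₁.2 (Finset.mem_filter.2 ⟨hv₁.1, h⟩))
        obtain ⟨u', hu', hmin⟩ := hR _ hvR
        exact ⟨u', hu', (hmin u hu huv).trans hd⟩)
      linarith)
    have := Finset.card_sdiff_add_card_eq_card hRU
    omega
  have h7 : V \ G = (V \ S) ∪ (S \ G) := by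
    ext v
    simp only [Finset.mem_union, Finset.mem_sdiff]
    have := @hSV v
    have := @hGS v
    tauto
  refine ⟨G, hGS.trans hSV, fun v hv => (Finset.mem_filter.1 hv).2, ?_, ?_⟩
  · have := Finset.card_union_le (V \ S) (S \ G)
    rw [h7]
    omega
  · have := Finset.card_union_le ((V \ S).image π) ((S \ G).image π)
    rw [h7, Finset.image_union]
    omega

lemma IsWellSeparated.eq_of_dist_le {γ : ℝ} {v v' x : X} (h : IsWellSeparated γ U V π v)
    (hv' : v' ∈ V) (hle : dist x v' ≤ dist x v) (hx : 2 * dist x v < γ * dist v (π v)) :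
    v' = v := by
  by_contra hne
  have h1 := h.1 v' hv' hne
  have h2 := dist_triangle_left v v' x
  linarith

/-- In a well-separated pair, the robust center `π v` is almost as good for the points assigned
to `v` as the center `v`. -/
lemma IsWellSeparated.cost_le (hdist : ∀ x y : X, dist x y ≠ 0 → 1 ≤ dist x y)
    (hw : ∀ x, 0 < w x) {P Q : Finset X} {a : X → X} {v : X}
    (h : IsWellSeparated 4000 U V π v) (hU1 : 1 < U.card) (hrob : IsRobustCenter w P U (π v))
    (hPQ : P ⊆ Q) (ha : ∀ x, a x ∈ V ∧ distTo x V = dist x (a x)) (hv : v ∈ V) (hVQ : V ⊆ Q)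
    (htag : ∀ x ∈ Q, a x = v → x ∈ P) :
    ∑ x ∈ Q with a x = v, w x * dist x (π v) ≤ 3 / 2 * ∑ x ∈ Q with a x = v, w x * dist x v := by
  -- Co-located centers serve equally well; otherwise the distance is at least `1`, as the
  -- robustness comparison requires.
  rcases eq_or_ne (dist v (π v)) 0 with h0 | h0
  · rw [Finset.mul_sum]
    refine Finset.sum_le_sum fun x _ => ?_
    have h1 := dist_triangle x v (π v)
    have h2 : dist x (π v) ≤ dist x v := by linarith
    have h3 := mul_le_mul_of_nonneg_left h2 (hw x).le
    have h4 := mul_nonneg (hw x).le (dist_nonneg (x := x) (y := v))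
    linarith
  · have h1 := hdist _ _ h0
    have hnear : ∀ x, dist x v ≤ 400 * dist v (π v) → a x = v := fun x hx => by
      have h2 := distTo_le_dist (x := x) hv
      rw [(ha x).2] at h2
      exact h.eq_of_dist_le (ha x).1 h2 (by linarith)
    obtain ⟨t, ht, hr⟩ := hrob
    have ht1 : distTo (π v) (U.erase (π v)) / 200 ≤ (10 : ℝ) ^ t := ht.1
    have hE : (U.erase (π v)).Nonempty := by
      obtain ⟨y, hy, hne⟩ := Finset.exists_mem_ne hU1 (π v)
      exact ⟨y, Finset.mem_erase.2 ⟨hne, hy⟩⟩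
    obtain ⟨y, hy, hyd⟩ := exists_distTo_eq hE (π v)
    rw [Finset.mem_erase] at hy
    have h2 := h.2 y hy.2 hy.1
    -- The separation `4000` is `200 · 20`: `200` from the scale of a robust center, `20` from the
    -- comparison.
    refine hr.cost_le hw ?_ (by rwa [dist_comm]) (by rw [dist_comm]; linarith) ?_ ?_
    · exact htag v (hVQ hv) (hnear v (by rw [dist_self]; positivity))
    · exact fun x hx => htag x (Finset.mem_filter.1 hx).1 (Finset.mem_filter.1 hx).2
    · exact fun x hx hxv => Finset.mem_filter.2 ⟨hPQ hx, hnear x (by rwa [dist_comm v])⟩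

/-- After at most `ℓ + 1` insertions into `P`, there is a solution obtained from `U` by at most
`5 ℓ + 5` swaps which is almost as good as `V`. -/
lemma exists_swap_solution [Finite X] (hdist : ∀ x y : X, dist x y ≠ 0 → 1 ≤ dist x y)
    (hw : ∀ x, 0 < w x) {k ℓ : ℕ} {P I : Finset X} (hI : I.card ≤ ℓ + 1) (hUP : U ⊆ P)
    (hUk : U.card ≤ k) (hrob : ∀ u ∈ U, IsRobustCenter w P U u)
    (hmax : ∀ T ⊆ U, cost w T P ≤ 228000 * cost w U P → k ≤ T.card + ℓ)
    (hVQ : V ⊆ P ∪ I) (hVk : V.card ≤ k) (hcost : cost w V P ≤ 18 * cost w U P) :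
    ∃ T ⊆ P ∪ I, T.card ≤ k ∧ (U \ T).card ≤ 5 * ℓ + 5 ∧ (T \ U).card ≤ 5 * ℓ + 5 ∧
      cost w T (P ∪ I) ≤ 3 / 2 * cost w V (P ∪ I) := by
  have hPQ : P ⊆ P ∪ I := Finset.subset_union_left
  have hV0 := cost_nonneg hw V (P ∪ I)
  have hU0 := cost_nonneg hw U P
  rcases le_or_gt U.card 1 with hU1 | hU1
  · have h1 := hmax U subset_rfl (by linarith)
    have h2 := Finset.card_le_card (Finset.sdiff_subset (s := U) (t := V))
    have h3 := Finset.card_le_card (Finset.sdiff_subset (s := V) (t := U))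
    exact ⟨V, hVQ, hVk, by omega, by omega, by linarith⟩
  rcases V.eq_empty_or_nonempty with rfl | hV
  · have h1 := cost_anti_left hw (Finset.empty_subset U) (P ∪ I)
    exact ⟨U, hUP.trans hPQ, hUk, by simp, by simp, by linarith⟩
  obtain ⟨π, hπ⟩ := exists_nearest (S := U) (Finset.card_pos.1 (by omega))
  obtain ⟨a, ha⟩ := exists_nearest hV
  obtain ⟨G, hGV, hG, hc1, hc2⟩ := exists_wellSeparated hw hUk hU1 hV hVk hmax hcost hπ
  -- Robustness refers to `P` only, so cells that receive an inserted point keep their center `v`;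
  -- there are at most `ℓ + 1` of them.
  set H := G \ I.image a with hH
  have hHV : V \ H ⊆ (V \ G) ∪ I.image a := by
    intro v
    simp only [hH, Finset.mem_sdiff, Finset.mem_union]
    tauto
  have htags : (I.image a).card ≤ ℓ + 1 := Finset.card_image_le.trans hI
  set f : X → X := fun v => if v ∈ H then π v else v with hf
  refine ⟨V.image f, ?_, Finset.card_image_le.trans hVk, ?_, ?_, ?_⟩
  · refine Finset.image_subset_iff.2 fun v hv => ?_
    by_cases hvH : v ∈ H
    · simpa only [hf, hvH, if_true] using hPQ (hUP (hπ v).1)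
    · simpa only [hf, hvH, if_false] using hVQ hv
  · have hsub : U \ V.image f ⊆ (U \ V.image π) ∪ (((V \ G).image π) ∪ (I.image a).image π) := by
      rw [← Finset.image_union]
      intro u hu
      rw [Finset.mem_sdiff] at hu
      by_cases huπ : u ∈ V.image π
      · refine Finset.mem_union_right _ (Finset.image_subset_image hHV ?_)
        obtain ⟨v, hv, rfl⟩ := Finset.mem_image.1 huπ
        refine Finset.mem_image_of_mem π (Finset.mem_sdiff.2 ⟨hv, fun hvH => hu.2 ?_⟩)
        exact Finset.mem_image.2 ⟨v, hv, by simp [hf, hvH]⟩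
      · exact Finset.mem_union_left _ (Finset.mem_sdiff.2 ⟨hu.1, huπ⟩)
    have h1 := Finset.card_le_card hsub
    have h2 := Finset.card_union_le (U \ V.image π) (((V \ G).image π) ∪ (I.image a).image π)
    have h3 := Finset.card_union_le ((V \ G).image π) ((I.image a).image π)
    have h4 : ((I.image a).image π).card ≤ (I.image a).card := Finset.card_image_le
    omega
  · have hsub : V.image f \ U ⊆ (V \ G) ∪ I.image a := by
      refine subset_trans (fun y hy => ?_) hHV
      rw [Finset.mem_sdiff, Finset.mem_image] at hy
      obtain ⟨⟨v, hv, rfl⟩, hyU⟩ := hy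
      by_cases hvH : v ∈ H
      · simp only [hf, hvH, if_true] at hyU
        exact absurd (hπ v).1 hyU
      · simpa only [hf, hvH, if_false] using Finset.mem_sdiff.2 ⟨hv, hvH⟩
    have h1 := Finset.card_le_card hsub
    have h2 := Finset.card_union_le (V \ G) (I.image a)
    omega
  · refine cost_le_of_fiberwise hw ha (fun v hv => Finset.mem_image_of_mem f hv) fun v hv => ?_
    by_cases hvH : v ∈ H
    · simp only [hf, hvH, if_true]
      rw [hH, Finset.mem_sdiff] at hvH
      refine (hG v hvH.1).cost_le hdist hw hU1 (hrob _ (hπ v).1) hPQ ha hv hVQ fun x hx hax => ?_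
      refine (Finset.mem_union.1 hx).resolve_right fun hxI => hvH.2 ?_
      exact hax ▸ Finset.mem_image_of_mem a hxI
    · simp only [hf, hvH, if_false]
      exact le_mul_of_one_le_left (Finset.sum_nonneg fun x _ => mul_nonneg (hw x).le dist_nonneg)
        (by norm_num)

end WellSeparated

/-! ### Runs of the epoch and their guarantees -/

section Epoch

variable {X : Type*}

lemma card_inserted_le [DecidableEq X] (σ : ℕ → X) (i : ℕ) : (inserted σ i).card ≤ i :=
  Finset.card_image_le.trans (by simp)

lemma subset_pointsAfter [DecidableEq X] (P : Finset X) (σ : ℕ → X) (i : ℕ) : P ⊆ pointsAfter P σ i :=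
  Finset.subset_union_left

variable [PseudoMetricSpace X] {w : X → ℝ}

lemma exists_removalStep (hw : ∀ x, 0 < w x) {k : ℕ} {P U : Finset X} (hUk : U.card ≤ k) :
    ∃ ℓ K, RemovalStep w k 228000 P U ℓ K := by
  classical
  have hU0 := cost_nonneg hw U P
  -- A smallest admissible `K` with `ℓ = k - |K|` meets both the budget and the maximality
  -- condition.
  obtain ⟨K, hK, hmin⟩ := Finset.exists_min_image
    (U.powerset.filter fun V => cost w V P ≤ 228000 * cost w U P) Finset.card
    ⟨U, by simp only [Finset.mem_filter, Finset.mem_powerset_self, true_and]; linarith⟩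
  simp only [Finset.mem_filter, Finset.mem_powerset] at hK hmin
  have hKk := (Finset.card_le_card hK.1).trans hUk
  refine ⟨k - K.card, K, hK.1, by omega, by linarith, fun V hV hVc => ?_⟩
  have := hmin V ⟨hV, hVc⟩
  omega

variable [DecidableEq X]

lemma exists_swapStep (hw : ∀ x, 0 < w x) {k : ℕ} {P U : Finset X} (hUP : U ⊆ P)
    (hUk : U.card ≤ k) (s : ℕ) : ∃ W, SwapStep w k P U s W := by
  classical
  obtain ⟨W, hW, hmin⟩ := Finset.exists_min_image
    (P.powerset.filter fun V => V.card ≤ k ∧ (U \ V).card ≤ s ∧ (V \ U).card ≤ s)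
    (fun V => cost w V P) ⟨U, by simp [hUP, hUk]⟩
  simp only [Finset.mem_filter, Finset.mem_powerset] at hW hmin
  refine ⟨W, hW.1, hW.2.1, by omega, fun V hV hVk h1 h2 => ?_⟩
  have := hmin V ⟨hV, hVk, h1, h2⟩
  have := cost_nonneg hw V P
  linarith

lemma exists_isEpochRun (hw : ∀ x, 0 < w x) {k : ℕ} {P₀ U₀ : Finset X} (hUP : U₀ ⊆ P₀)
    (hUk : U₀.card ≤ k) (σ : ℕ → X) : ∃ ℓ U, IsEpochRun w k P₀ σ U₀ ℓ U := by
  obtain ⟨ℓ, K, hK⟩ := exists_removalStep hw (P := P₀) hUk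
  obtain ⟨W, hW⟩ := exists_swapStep hw (hUP.trans (subset_pointsAfter P₀ σ (ℓ + 1))) hUk (5 * ℓ + 5)
  obtain ⟨Z, hZ⟩ := exists_isRobustifyOutput hw hW.subset
  refine ⟨ℓ, fun i => if i = 0 then U₀ else if i ≤ ℓ then K ∪ inserted σ i else Z, by simp,
    ⟨K, hK, fun i h1 h2 => ?_⟩, ⟨W, hW, by simpa using hZ⟩⟩
  simp [h2, Nat.one_le_iff_ne_zero.1 h1]

lemma RemovalStep.isApprox [Finite X] (hw : ∀ x, 0 < w x) {k ℓ i : ℕ} {P₀ U₀ K : Finset X}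
    (h : RemovalStep w k 228000 P₀ U₀ ℓ K) (hU : IsApprox w k 100 P₀ U₀) (σ : ℕ → X) (hi : i ≤ ℓ) :
    IsApprox w k (6 * 100 * 228000) (pointsAfter P₀ σ i) (K ∪ inserted σ i) := by
  refine ⟨Finset.union_subset_union_left (h.subset.trans hU.subset), ?_, ?_⟩
  · have h1 := Finset.card_union_le K (inserted σ i)
    have h2 := card_inserted_le σ i
    have h3 := h.card_le
    omega
  · have h1 : cost w (K ∪ inserted σ i) (pointsAfter P₀ σ i) =
        cost w (K ∪ inserted σ i) P₀ := by
      refine (Finset.sum_subset (subset_pointsAfter P₀ σ i) fun x hx hxP => ?_).symm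
      have hxI : x ∈ K ∪ inserted σ i :=
        Finset.mem_union_right _ ((Finset.mem_union.1 hx).resolve_left hxP)
      have h2 := distTo_le_dist (x := x) hxI
      rw [dist_self] at h2
      rw [le_antisymm h2 (distTo_nonneg _ _), mul_zero]
    have h2 := cost_anti_left hw (Finset.subset_union_left (s₁ := K) (s₂ := inserted σ i)) P₀
    have h3 := h.cost_le
    have h4 := hU.cost_le
    have h5 := opt_le_two_mul_opt hw k (subset_pointsAfter P₀ σ i)
    linarith

lemma boundedRobust_of_isRobustifyOutput [Finite X]
    (hdist : ∀ x y : X, dist x y ≠ 0 → 1 ≤ dist x y) (hw : ∀ x, 0 < w x) {k ℓ : ℕ}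
    {P₀ U₀ K W Z : Finset X} {σ : ℕ → X} (hU : BoundedRobust w k P₀ U₀)
    (hK : RemovalStep w k 228000 P₀ U₀ ℓ K)
    (hW : SwapStep w k (pointsAfter P₀ σ (ℓ + 1)) U₀ (5 * ℓ + 5) W)
    (hZ : IsRobustifyOutput w (pointsAfter P₀ σ (ℓ + 1)) W Z)
    (hopt : opt w k (pointsAfter P₀ σ (ℓ + 1)) ≤ 18 * opt w k P₀) :
    BoundedRobust w k (pointsAfter P₀ σ (ℓ + 1)) Z := by
  refine ⟨⟨hZ.subset hW.subset, (hZ.card_le hw).trans hW.card_le, ?_⟩, hZ.2⟩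
  obtain ⟨V, hVQ, hVk, hV⟩ := exists_opt_eq w k (pointsAfter P₀ σ (ℓ + 1))
  have h1 := cost_mono_right hw V (subset_pointsAfter P₀ σ (ℓ + 1))
  have h2 := opt_le (w := w) hU.approx.subset hU.approx.card_le
  obtain ⟨T, hTQ, hTk, hT1, hT2, hT⟩ := exists_swap_solution hdist hw
    (card_inserted_le σ (ℓ + 1)) hU.approx.subset hU.approx.card_le hU.robust hK.maximal hVQ hVk
    (by linarith)
  have h3 := hW.cost_le T hTQ hTk hT1 hT2
  have h4 := hZ.cost_le hw
  have h5 := cost_nonneg hw V (pointsAfter P₀ σ (ℓ + 1))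
  change cost w T (pointsAfter P₀ σ (ℓ + 1)) ≤ 3 / 2 * cost w V (pointsAfter P₀ σ (ℓ + 1)) at hT
  rw [hV]
  -- `3/2 · 13 · 3/2 = 29.25 ≤ 100`.
  linarith

end Epoch
end ConsistentKMedian

theorem mainTheorem2 {X : Type*} [Finite X] [PseudoMetricSpace X] [DecidableEq X]
    (hdist : ∀ x y : X, dist x y ≠ 0 → 1 ≤ dist x y)
    (w : X → ℝ) (hw : ∀ x, 0 < w x) (k : ℕ)
    (P₀ : Finset X) (σ : ℕ → X) (U₀ : Finset X) (hU₀ : BoundedRobust w k P₀ U₀) :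
    (∀ P W : Finset X, W ⊆ P → RobustifyTerminates w P W) ∧
    (∃ (ℓ : ℕ) (U : ℕ → Finset X), IsEpochRun w k P₀ σ U₀ ℓ U) ∧
    ∀ (ℓ : ℕ) (U : ℕ → Finset X), IsEpochRun w k P₀ σ U₀ ℓ U →
      (∀ i, 1 ≤ i → i ≤ ℓ → IsApprox w k (6 * 100 * 228000) (pointsAfter P₀ σ i) (U i)) ∧
      (opt w k (pointsAfter P₀ σ (ℓ + 1)) ≤ 18 * opt w k P₀ →
        BoundedRobust w k (pointsAfter P₀ σ (ℓ + 1)) (U (ℓ + 1))) := by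
  refine ⟨fun P W _ => robustifyTerminates hw P W,
    exists_isEpochRun hw hU₀.approx.subset hU₀.approx.card_le σ, fun ℓ U hrun => ?_⟩
  obtain ⟨K, hK, hKU⟩ := hrun.insertions
  obtain ⟨W, hW, hZ⟩ := hrun.final
  refine ⟨fun i h1 hi => ?_, fun hopt =>
    boundedRobust_of_isRobustifyOutput hdist hw hU₀ hK hW hZ hopt⟩
  rw [hKU i h1 hi]
  exact hK.isApprox hw hU₀.approx σ hi
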